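/- Let $\mathbb F$ be a field, $n\ge 1$, and let $\sigma$ be the automorphism of the rational function field $\mathbb F(\alpha_1,\dots,\alpha_n)$ with $\sigma|_{\mathbb F}=\mathrm{id}$ and $\sigma(\alpha_i)=\lambda_i\alpha_i$ for $1\le i\le n$, where $\lambda_1,\dots,\lambda_n\in\mathbb F\setminus\{0\}$. For $p,q\in\mathbb F[\alpha_1,\dots,\alpha_n]$ put $$\operatorname{Spr}_\sigma(p,q)=\{\ell\in\mathbb Z : \sigma^\ell(p)=e\,q\text{ for some }e\in\mathbb F\setminus\{0\}\},$$ and write $p\sim_\sigma q$ if this set is nonempty. For $e\in\mathbb F$ and a power $\tau$ of $\sigma$ put $\Delta_{e\tau}(g)=e\,\tau(g)-g$. An element $f\in\mathbb F(\alpha_1,\dots,\alpha_n)$ is called $c\sigma$-summable in $\mathbb F(\alpha_1,\dots,\alpha_n)$ if $f=\Delta_{c\sigma}(g)$ for some $g\in\mathbb F(\alpha_1,\dots,\alpha_n)$. The degree of the zero polynomial is $-\infty$. Let $c\in\mathbb F\setminus\{0\}$, let $j\ge 1$ be an integer, let $d\in\mathbb F[\alpha_1,\dots,\alpha_n]$ be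 irreducible with $d\nsim_\sigma\alpha_n$, and let $a\in\mathbb F(\alpha_1,\dots,\alpha_{n-1})[\alpha_n]$ with $\deg_{\alpha_n}(a)<\deg_{\alpha_n}(d)$. Suppose that $\operatorname{Spr}_\sigma(d,d)=k\mathbb Z$ with an integer $k\ge 1$ and that $\sigma^k(d)=u\,d$ with $u\in\mathbb F\setminus\{0\}$. Put $\varepsilon=c^ku^{-j}$. Then $f=a/d^j$ is $c\sigma$-summable in $\mathbb F(\alpha_1,\dots,\alpha_n)$ if and only if $$a=\Delta_{\varepsilon\sigma^k}(b)=\varepsilon\,\sigma^k(b)-b$$ for some $b\in\mathbb F(\alpha_1,\dots,\alpha_{n-1})[\alpha_n]$ with $\deg_{\alpha_n}(b)<\deg_{\alpha_n}(d)$; and this equivalence also holds with the condition $\deg_{\alpha_n}(b)\le\deg_{\alpha_n}(a)$ in place of $\deg_{\alpha_n}(b)<\deg_{\alpha_n}(d)$. -/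

import Mathlib

noncomputable section

namespace DiffField

open MvPolynomial

/-- The field `F(α₁, …, αₙ)` of rational functions in `n` variables over `F`. -/
abbrev RatField (F : Type*) [Field F] (n : ℕ) : Type _ :=
  FractionRing (MvPolynomial (Fin n) F)

/-- The variable `αᵢ`, as an element of `F(α₁, …, αₙ)`. -/
def gen (F : Type*) [Field F] {n : ℕ} (i : Fin n) : RatField F n :=
  algebraMap (MvPolynomial (Fin n) F) (RatField F n) (X i)

/-- The automorphism of `F[α₁, …, αₙ]` over `F` with `αᵢ ↦ λᵢ αᵢ`. -/
def sigmaPoly {F : Type*} [Field F] {n : ℕ} (lam : Fin n → Fˣ) :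
    MvPolynomial (Fin n) F ≃ₐ[F] MvPolynomial (Fin n) F :=
  AlgEquiv.ofAlgHom
    (aeval fun i => C (lam i : F) * X i)
    (aeval fun i => C ((lam i)⁻¹ : F) * X i)
    (by
      ext i : 1
      simp only [AlgHom.comp_apply, aeval_X, map_mul, algHom_C, AlgHom.id_apply, algebraMap_eq]
      rw [← mul_assoc, ← C_mul, inv_mul_cancel₀ (lam i).ne_zero, C_1, one_mul])
    (by
      ext i : 1
      simp only [AlgHom.comp_apply, aeval_X, map_mul, algHom_C, AlgHom.id_apply, algebraMap_eq]
      rw [← mul_assoc, ← C_mul, mul_inv_cancel₀ (lam i).ne_zero, C_1, one_mul])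

/-- The automorphism `σ` of `F(α₁, …, αₙ)` over `F` with `αᵢ ↦ λᵢ αᵢ`. -/
def sigma {F : Type*} [Field F] {n : ℕ} (lam : Fin n → Fˣ) :
    RatField F n ≃ₐ[F] RatField F n :=
  IsFractionRing.fieldEquivOfAlgEquiv F (RatField F n) (RatField F n) (sigmaPoly lam)

theorem sigma_algebraMap {F : Type*} [Field F] {n : ℕ} (lam : Fin n → Fˣ)
    (p : MvPolynomial (Fin n) F) :
    sigma lam (algebraMap _ (RatField F n) p) = algebraMap _ (RatField F n) (sigmaPoly lam p) :=
  IsFractionRing.fieldEquivOfAlgEquiv_algebraMap F _ _ (sigmaPoly lam) p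

theorem sigma_gen {F : Type*} [Field F] {n : ℕ} (lam : Fin n → Fˣ) (i : Fin n) :
    sigma lam (gen F i) = (lam i : F) • gen F i := by
  rw [gen, sigma_algebraMap, Algebra.smul_def,
    IsScalarTower.algebraMap_apply F (MvPolynomial (Fin n) F) (RatField F n), ← map_mul]
  simp [sigmaPoly]

/-- The spread set `Spr_σ(p, q)`: all integers `k` such that `σᵏ(p) = c q` for some nonzero
`c ∈ F`. -/
def spread {F : Type*} [Field F] {n : ℕ} (lam : Fin n → Fˣ) (p q : MvPolynomial (Fin n) F) :
    Set ℤ :=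
  {k | ∃ c : F, c ≠ 0 ∧ (sigmaPoly lam ^ k) p = C c * q}

/-- Equivalence `p ∼_σ q` of polynomials with respect to `σ`. -/
def SigmaEquiv {F : Type*} [Field F] {n : ℕ} (lam : Fin n → Fˣ)
    (p q : MvPolynomial (Fin n) F) : Prop :=
  (spread lam p q).Nonempty

/-- The operator `Δ_{cτ}(g) = c τ(g) - g`. -/
def delta {F : Type*} [Field F] {n : ℕ} (c : F) (τ : RatField F n ≃ₐ[F] RatField F n)
    (g : RatField F n) : RatField F n :=
  c • τ g - g

/-- `f` is `cσ`-summable in `F(α₁, …, αₙ)`. -/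
def IsSummable {F : Type*} [Field F] {n : ℕ} (lam : Fin n → Fˣ) (c : F) (f : RatField F n) :
    Prop :=
  ∃ g : RatField F n, f = delta c (sigma lam) g

/-- The subfield of the field of rational functions in `m + 1` variables generated over `F` by
all the variables but the last one. -/
def coeffField (F : Type*) [Field F] (m : ℕ) : IntermediateField F (RatField F (m + 1)) :=
  IntermediateField.adjoin F (Set.range fun i : Fin m => gen F i.castSucc)

/-- The element of `F(α₁, …, αₙ)` given by a polynomial in `αₙ` with coefficients in
`F(α₁, …, αₙ₋₁)`, where `n = m + 1`. -/
def evalLast {F : Type*} [Field F] {m : ℕ} (a : Polynomial (coeffField F m)) :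
    RatField F (m + 1) :=
  Polynomial.aeval (gen F (Fin.last m)) a

end DiffField

end

/-! Write `K` for the field of rational functions in all variables but the last. Composing `cσ - 1`
with the geometric sum of the `(cσ)^i`, `i < k`, gives `(cσ)^k - 1`. Hence if `f = Δ_{cσ}(g)`, then
`Δ_{c^kσ^k}(g)` is `f` plus the terms `(cσ)^i(f)`, `0 < i < k`. Their denominators `σ^i(d)^j` are
coprime to `d` in `K[αₙ]`, since `k` is the period of `d` (`isCoprime_sigmaLift_pow_toPoly`, via
Gauss's lemma).

So the equation can be read locally at `d`, which `σ^k` fixes up to a unit. With `A / d^(M+j)` the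
`d`-primary part of `g`, it becomes a congruence for `A` modulo `d^(M+j)` with right-hand side `a
d^M`. As `σ^k` preserves degrees in `αₙ`, remainders modulo a `σ^k`-stable polynomial turn
congruences into equations (`mul_map_mod_sub_eq`). Used modulo `d^M` this removes the poles of order
above `j`; used modulo `d` it yields `b` (`exists_reduced_solution`). Used modulo a power of `αₙ` it
gives the bound by the degree of `a`.

Conversely `Δ_{c^kσ^k}(b / d^j) = a / d^j`, and `(cσ)^k - 1` factors through `cσ - 1`. -/

namespace DiffField

/-! ### Remainders and localisation at `d`, for a degree-preserving endomorphism of `K[X]`. -/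

section Abstract

open Polynomial

variable {K : Type*} [Field K] (S : K[X] →+* K[X])

/-- A solution `B` of `e S(B) - B ≡ a` modulo an `S`-stable `p` of larger degree than `a` reduces
to an exact solution. -/
theorem mul_map_mod_sub_eq (hS : ∀ p, (S p).degree = p.degree) {p a B : K[X]} (e : K)
    (hp : p ∣ S p) (ha : a.degree < p.degree) (h : p ∣ C e * S B - B - a) :
    C e * S (B % p) - B % p = a := by
  have hp0 : p ≠ 0 := by rintro rfl; simp at ha
  have hr : (B % p).degree < p.degree := EuclideanDomain.mod_lt B hp0
  have hdvd : p ∣ C e * S (B % p) - B % p - a := by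
    have hB : B % p = B - p * (B / p) := by
      rw [eq_sub_iff_add_eq]; exact EuclideanDomain.mod_add_div B p
    have : C e * S (B % p) - B % p - a =
        (C e * S B - B - a) - C e * (S p * S (B / p)) + p * (B / p) := by
      rw [hB, map_sub, map_mul]; ring
    rw [this]
    exact dvd_add (dvd_sub h ((hp.mul_right _).mul_left _)) (dvd_mul_right _ _)
  refine sub_eq_zero.mp (eq_zero_of_dvd_of_degree_lt hdvd ?_)
  refine (degree_sub_le _ _).trans_lt (max_lt ((degree_sub_le _ _).trans_lt (max_lt ?_ hr)) ha)
  refine lt_of_le_of_lt ?_ hr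
  rw [degree_mul, hS]
  by_cases he : e = 0
  · simp [he]
  · simp [degree_C he]

/-- The coefficient extraction step: a solution at the `d`-adic level `M + j` gives a solution of
the reduced equation. -/
theorem exists_reduced_solution (hS : ∀ p, (S p).degree = p.degree) {d a A : K[X]} {e u : K}
    (hd0 : d ≠ 0) (hdu : S d = C u * d) (M j : ℕ) (hj : 0 < j) (ha : a.degree < d.degree)
    (h : d ^ (M + j) ∣ C e * S A - A - a * d ^ M) :
    ∃ b : K[X], b.degree < d.degree ∧ C (e * u ^ M) * S b - b = a := by
  have hM0 : d ^ M ≠ 0 := pow_ne_zero _ hd0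
  have hSd : d ∣ S d := ⟨C u, by rw [hdu, mul_comm]⟩
  have hSM : d ^ M ∣ S (d ^ M) := by rw [map_pow]; exact pow_dvd_pow_of_dvd hSd M
  -- Modulo `d ^ M` the term `a * d ^ M` vanishes, so the remainder solves the homogeneous equation
  -- exactly and can be subtracted from `A`.
  have hA' : C e * S (A % d ^ M) - A % d ^ M = 0 := by
    refine mul_map_mod_sub_eq S hS e hSM ?_ ?_
    · rw [degree_zero]; exact bot_lt_iff_ne_bot.mpr (degree_ne_bot.mpr hM0)
    · rw [sub_zero]
      have h1 : d ^ M ∣ C e * S A - A - a * d ^ M := (pow_dvd_pow d (M.le_add_right j)).trans h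
      exact (dvd_sub_left (dvd_mul_left _ _)).mp h1
  have hA : d ^ M * (A / d ^ M) + A % d ^ M = A := EuclideanDomain.div_add_mod A (d ^ M)
  set B := A / d ^ M
  set A' := A % d ^ M
  have hB : d ^ j ∣ C (e * u ^ M) * S B - B - a := by
    rw [pow_add] at h
    refine (mul_dvd_mul_iff_left hM0).mp (h.trans (dvd_of_eq ?_))
    rw [← hA, map_add, map_mul, map_pow, hdu, C_mul, C_pow]
    linear_combination hA'
  refine ⟨B % d, EuclideanDomain.mod_lt B hd0, ?_⟩
  exact mul_map_mod_sub_eq S hS _ hSd ha ((dvd_pow_self d hj.ne').trans hB)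

variable {L : Type*} [Field L] (ι : K[X] →+* L)

/-- `x` is a fraction whose denominator is coprime to `d`. -/
def HasCoprimeDenom (d : K[X]) (x : L) : Prop :=
  ∃ P Q : K[X], IsCoprime Q d ∧ x * ι Q = ι P

variable {ι}

theorem HasCoprimeDenom.add {d : K[X]} {x y : L} (hx : HasCoprimeDenom ι d x)
    (hy : HasCoprimeDenom ι d y) : HasCoprimeDenom ι d (x + y) := by
  obtain ⟨P, Q, hQ, h⟩ := hx
  obtain ⟨P', Q', hQ', h'⟩ := hy
  refine ⟨P * Q' + P' * Q, Q * Q', hQ.mul_left hQ', ?_⟩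
  simp only [map_add, map_mul, ← h, ← h']
  ring

theorem HasCoprimeDenom.of_poly (d p : K[X]) : HasCoprimeDenom ι d (ι p) :=
  ⟨p, 1, isCoprime_one_left, by simp⟩

theorem HasCoprimeDenom.poly_mul {d : K[X]} {x : L} (p : K[X]) (hx : HasCoprimeDenom ι d x) :
    HasCoprimeDenom ι d (ι p * x) := by
  obtain ⟨P, Q, hQ, h⟩ := hx
  exact ⟨p * P, Q, hQ, by rw [mul_assoc, h, map_mul]⟩

theorem HasCoprimeDenom.sum {α : Type*} {d : K[X]} {x : α → L} {s : Finset α}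
    (hx : ∀ i ∈ s, HasCoprimeDenom ι d (x i)) : HasCoprimeDenom ι d (∑ i ∈ s, x i) :=
  Finset.sum_induction x _ (fun _ _ => HasCoprimeDenom.add)
    (by simpa using HasCoprimeDenom.of_poly (ι := ι) d 0) hx

theorem HasCoprimeDenom.sub {d : K[X]} {x y : L} (hx : HasCoprimeDenom ι d x)
    (hy : HasCoprimeDenom ι d y) : HasCoprimeDenom ι d (x - y) := by
  have := hx.add (hy.poly_mul (-1))
  simpa [sub_eq_add_neg] using this

/-- Coprimality of `Q` and `d` passes to `S Q` and `S d`, and `d` divides `S d`. -/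
theorem HasCoprimeDenom.map {d : K[X]} {x : L} {s : L →+* L}
    (hs : ∀ p, s (ι p) = ι (S p)) {u : K}
    (hdu : S d = C u * d) (hx : HasCoprimeDenom ι d x) :
    HasCoprimeDenom ι d (s x) := by
  obtain ⟨P, Q, hQ, h⟩ := hx
  refine ⟨S P, S Q, ?_, by rw [← hs, ← hs, ← map_mul, h]⟩
  have := hQ.map S
  rw [hdu] at this
  exact this.of_mul_right_right

theorem HasCoprimeDenom.pow_dvd {d z : K[X]} {n : ℕ} (hι : Function.Injective ι) (hd0 : d ≠ 0)
    (hz : HasCoprimeDenom ι d (ι z / ι d ^ n)) : d ^ n ∣ z := by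
  obtain ⟨P, Q, hQ, h⟩ := hz
  have hd' : ι d ^ n ≠ 0 := pow_ne_zero _ ((map_ne_zero_iff ι hι).mpr hd0)
  rw [div_mul_eq_mul_div, div_eq_iff hd', ← map_mul, ← map_pow, ← map_mul] at h
  exact (hQ.pow_right (n := n)).symm.dvd_of_dvd_mul_right ⟨P, by rw [hι h, mul_comm]⟩

/-- Every fraction has a `d`-primary part. -/
theorem exists_primary_part (hι : Function.Injective ι)
    (hfrac : ∀ x : L, ∃ P Q : K[X], Q ≠ 0 ∧ x * ι Q = ι P) {d : K[X]} (hd : Irreducible d)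
    (j : ℕ) (g : L) :
    ∃ (M : ℕ) (A : K[X]) (y : L), HasCoprimeDenom ι d y ∧ g = ι A / ι d ^ (M + j) + y := by
  obtain ⟨P, Q₀, hQ₀, hg⟩ := hfrac g
  obtain ⟨M, Q, hQ, rfl⟩ := WfDvdMonoid.max_power_factor hQ₀ hd
  have hco : IsCoprime Q d := ((hd.coprime_iff_not_dvd).mpr hQ).symm
  obtain ⟨x, y, hxy⟩ : IsCoprime Q (d ^ (M + j)) := hco.pow_right
  have hQ1 : ι Q ≠ 0 := (map_ne_zero_iff ι hι).mpr (right_ne_zero_of_mul hQ₀)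
  have hd1 : ι d ≠ 0 := (map_ne_zero_iff ι hι).mpr hd.ne_zero
  -- Multiply `g = P / (d^M Q)` by `1 = xQ + y d^(M+j)`. The extra factor `d ^ j` makes the pole
  -- order at least `j`, as comparison with `a / d^j` requires.
  refine ⟨M, x * P * d ^ j, ι (y * P * d ^ j) / ι Q,
    ⟨y * P * d ^ j, Q, hco, div_mul_cancel₀ _ hQ1⟩, ?_⟩
  have h1 : ι x * ι Q + ι y * ι d ^ (M + j) = 1 := by
    simpa using congrArg ι hxy
  have h2 : g = ι P / (ι d ^ M * ι Q) := by
    rw [eq_div_iff (by positivity), ← hg, map_mul, map_pow]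
  rw [h2]
  simp only [map_mul, map_pow]
  rw [div_add_div _ _ (pow_ne_zero _ hd1) hQ1, div_eq_div_iff (by positivity) (by positivity)]
  linear_combination (-ι P * ι d ^ (M + j) * ι Q) * h1 

/-- If `a / d ^ j` is, up to fractions with denominator coprime to `d`, of the form `e τ(g) - g`,
then `a` is of the form `e u⁻ʲ τ(b) - b`. -/
theorem exists_solution_of_local (hS : ∀ p, (S p).degree = p.degree) (hι : Function.Injective ι)
    (hfrac : ∀ x : L, ∃ P Q : K[X], Q ≠ 0 ∧ x * ι Q = ι P) {s : L →+* L}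
    (hs : ∀ p, s (ι p) = ι (S p)) {d a : K[X]} (hd : Irreducible d) {e u : K} (hu : u ≠ 0)
    (hdu : S d = C u * d) {j : ℕ} (hj : 0 < j) (ha : a.degree < d.degree) {g h : L}
    (hh : HasCoprimeDenom ι d h) (hg : ι (C e) * s g - g = ι a / ι d ^ j + h) :
    ∃ b : K[X], b.degree < d.degree ∧ C (e * (u ^ j)⁻¹) * S b - b = a := by
  obtain ⟨M, A, y, hy, rfl⟩ := exists_primary_part hι hfrac hd j g
  have hd1 : ι d ≠ 0 := (map_ne_zero_iff ι hι).mpr hd.ne_zero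
  have hu1 : ι (C u) ≠ 0 := (map_ne_zero_iff ι hι).mpr (C_ne_zero.mpr hu)
  have hinv : ι (C (e * (u ^ (M + j))⁻¹)) * ι (C u) ^ (M + j) = ι (C e) := by
    rw [← map_pow, ← map_mul, ← C_pow, ← C_mul, mul_assoc, inv_mul_cancel₀ (pow_ne_zero _ hu),
      mul_one]
  have hdvd : d ^ (M + j) ∣ C (e * (u ^ (M + j))⁻¹) * S A - A - a * d ^ M := by
    refine HasCoprimeDenom.pow_dvd hι hd.ne_zero ?_
    have : ι (C (e * (u ^ (M + j))⁻¹) * S A - A - a * d ^ M) / ι d ^ (M + j) =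
        h + y - ι (C e) * s y := by
      have h3 : h = ι (C e) * s (ι A / ι d ^ (M + j) + y) - (ι A / ι d ^ (M + j) + y)
          - ι a / ι d ^ j := by rw [hg]; ring
      rw [h3, map_add, map_div₀, map_pow, hs, hs, hdu, ← hinv]
      simp only [map_mul, map_sub, map_pow]
      field_simp
      ring
    rw [this]
    exact (hh.add hy).sub ((hy.map S hs hdu).poly_mul _)
  obtain ⟨b, hb, hab⟩ := exists_reduced_solution S hS hd.ne_zero hdu M j hj ha hdvd
  refine ⟨b, hb, ?_⟩
  rw [← hab]
  -- The powers of `u` combine as `u^(-(M+j)) u^M = u^(-j)`.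
  congr 3
  rw [pow_add]
  field_simp

end Abstract

end DiffField

noncomputable section

namespace DiffField

open MvPolynomial

/-- Clearing the denominators of a polynomial over a field of fractions. -/
theorem exists_map_eq_C_mul {A K : Type*} [CommRing A] [IsDomain A] [Field K] [Algebra A K]
    [IsFractionRing A K] (p : Polynomial K) :
    ∃ (b : A) (q : Polynomial A), b ≠ 0 ∧
      q.map (algebraMap A K) = Polynomial.C (algebraMap A K b) * p := by
  obtain ⟨b, hb, hbp⟩ := IsLocalization.integerNormalization_spec (nonZeroDivisors A) p
  exact ⟨b, _, nonZeroDivisors.ne_zero hb, by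
    rw [hbp, ← algebraMap_smul K b p, Polynomial.smul_eq_C_mul]⟩

/-! ### The rational function field as the fraction field of `K[αₙ]`, and Gauss's lemma. -/

section Concrete

variable (F : Type*) [Field F] (m : ℕ)

/-- The variables but the last one, as elements of `coeffField F m`. -/
def coeffGen (i : Fin m) : coeffField F m :=
  ⟨gen F i.castSucc, IntermediateField.subset_adjoin F _ ⟨i, rfl⟩⟩

/-- The embedding of the polynomials in all variables but the last one into `coeffField F m`. -/
def coeffMap : MvPolynomial (Fin m) F →ₐ[F] coeffField F m :=
  aeval (coeffGen F m)

/-- Polynomials in `m + 1` variables as polynomials in the last variable. -/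
def lastEquiv : MvPolynomial (Fin (m + 1)) F ≃ₐ[F] Polynomial (MvPolynomial (Fin m) F) :=
  (renameEquiv F finSuccEquivLast).trans (optionEquivLeft F (Fin m))

/-- Polynomials in `m + 1` variables as polynomials in the last variable over `coeffField F m`. -/
def toPoly : MvPolynomial (Fin (m + 1)) F →+* Polynomial (coeffField F m) :=
  (Polynomial.mapRingHom (coeffMap F m : MvPolynomial (Fin m) F →+* coeffField F m)).comp
    (lastEquiv F m : MvPolynomial (Fin (m + 1)) F →+* Polynomial (MvPolynomial (Fin m) F))

/-- `evalLast` as a ring homomorphism. -/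
def evalLastHom : Polynomial (coeffField F m) →+* RatField F (m + 1) :=
  (Polynomial.aeval (R := coeffField F m) (gen F (Fin.last m))).toRingHom

variable {F m}

theorem evalLastHom_apply (p : Polynomial (coeffField F m)) : evalLastHom F m p = evalLast p := rfl

@[simp]
theorem evalLastHom_X : evalLastHom F m Polynomial.X = gen F (Fin.last m) :=
  Polynomial.aeval_X _

@[simp]
theorem evalLastHom_C (x : coeffField F m) : evalLastHom F m (Polynomial.C x) = x :=
  Polynomial.aeval_C _ x

theorem evalLastHom_C_algebraMap (x : F) :
    evalLastHom F m (Polynomial.C (algebraMap F (coeffField F m) x)) =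
      algebraMap F (RatField F (m + 1)) x :=
  evalLastHom_C _

theorem evalLastHom_toPoly (p : MvPolynomial (Fin (m + 1)) F) :
    evalLastHom F m (toPoly F m p) = algebraMap _ (RatField F (m + 1)) p := by
  suffices h : (evalLastHom F m).comp (toPoly F m) = algebraMap _ (RatField F (m + 1)) from
    DFunLike.congr_fun h p
  refine MvPolynomial.ringHom_ext (fun r => ?_) fun i => ?_
  · simp [toPoly, lastEquiv, coeffMap]
    rfl
  · refine Fin.lastCases ?_ (fun i => ?_) i
    · simp [toPoly, lastEquiv, gen]
    · simp [toPoly, lastEquiv, gen, coeffMap, coeffGen]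

theorem algebraicIndependent_gen_castSucc :
    AlgebraicIndependent F fun i : Fin m => gen F i.castSucc := by
  have h : AlgebraicIndependent F fun i : Fin (m + 1) => gen F i := by
    have := (MvPolynomial.algebraicIndependent_X (Fin (m + 1)) F).map'
      (f := IsScalarTower.toAlgHom F (MvPolynomial (Fin (m + 1)) F) (RatField F (m + 1)))
      (IsFractionRing.injective _ _)
    exact this
  exact h.comp _ (Fin.castSucc_injective m)

/-- This makes Gauss's lemma and clearing of denominators available over `coeffField F m`; it rests
on the algebraic independence of the variables. -/
theorem isFractionRing_coeffMap :
    letI := (coeffMap F m).toAlgebra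
    IsFractionRing (MvPolynomial (Fin m) F) (coeffField F m) := by
  let := (coeffMap F m).toAlgebra
  let e : FractionRing (MvPolynomial (Fin m) F) ≃ₐ[F] coeffField F m :=
    (algebraicIndependent_gen_castSucc (F := F) (m := m)).aevalEquivField
  have he : ∀ p, e (algebraMap _ _ p) = coeffMap F m p := by
    intro p
    have h : (coeffField F m).val.comp (coeffMap F m) =
        aeval fun i : Fin m => gen F i.castSucc := by
      ext i : 1
      simp [coeffMap, coeffGen]
    exact Subtype.ext
      ((AlgebraicIndependent.aevalEquivField_algebraMap_apply_coe _ p).trans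
        (DFunLike.congr_fun h p).symm)
  exact IsLocalization.isLocalization_of_algEquiv (nonZeroDivisors (MvPolynomial (Fin m) F))
    (AlgEquiv.ofRingEquiv (f := e.toRingEquiv) he)

theorem coeffMap_injective : Function.Injective (coeffMap F m) := by
  let := (coeffMap F m).toAlgebra
  have := isFractionRing_coeffMap (F := F) (m := m)
  exact IsFractionRing.injective (MvPolynomial (Fin m) F) (coeffField F m)

theorem toPoly_injective : Function.Injective (toPoly F m) :=
  (Polynomial.map_injective _ coeffMap_injective).comp (lastEquiv F m).injective

theorem natDegree_lastEquiv (p : MvPolynomial (Fin (m + 1)) F) :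
    (lastEquiv F m p).natDegree = degreeOf (Fin.last m) p := by
  rw [lastEquiv, AlgEquiv.trans_apply, natDegree_optionEquivLeft, renameEquiv_apply,
    ← finSuccEquivLast_last, degreeOf_rename_of_injective (Equiv.injective _)]

theorem degree_toPoly {p : MvPolynomial (Fin (m + 1)) F} (hp : p ≠ 0) :
    (toPoly F m p).degree = (degreeOf (Fin.last m) p : WithBot ℕ) := by
  rw [← natDegree_lastEquiv, ← Polynomial.degree_eq_natDegree (by simpa using hp)]
  exact Polynomial.degree_map_eq_of_injective coeffMap_injective _

theorem isPrimitive_lastEquiv {p : MvPolynomial (Fin (m + 1)) F} (hp : Irreducible p)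
    (h0 : degreeOf (Fin.last m) p ≠ 0) : (lastEquiv F m p).IsPrimitive :=
  Irreducible.isPrimitive ((MulEquiv.irreducible_iff (lastEquiv F m)).mpr hp)
    (by rwa [natDegree_lastEquiv])

theorem irreducible_toPoly {p : MvPolynomial (Fin (m + 1)) F} (hp : Irreducible p)
    (h0 : degreeOf (Fin.last m) p ≠ 0) : Irreducible (toPoly F m p) := by
  let := (coeffMap F m).toAlgebra
  have := isFractionRing_coeffMap (F := F) (m := m)
  let : NormalizedGCDMonoid (MvPolynomial (Fin m) F) := Nonempty.some inferInstance
  exact ((isPrimitive_lastEquiv hp h0).irreducible_iff_irreducible_map_fraction_map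
    (K := coeffField F m)).mp ((MulEquiv.irreducible_iff (lastEquiv F m)).mpr hp)

theorem dvd_of_toPoly_dvd_toPoly {p q : MvPolynomial (Fin (m + 1)) F} (hp : Irreducible p)
    (h0 : degreeOf (Fin.last m) p ≠ 0) (h : toPoly F m p ∣ toPoly F m q) : p ∣ q := by
  let := (coeffMap F m).toAlgebra
  have := isFractionRing_coeffMap (F := F) (m := m)
  let : NormalizedGCDMonoid (MvPolynomial (Fin m) F) := Nonempty.some inferInstance
  have := (isPrimitive_lastEquiv hp h0).dvd_of_fraction_map_dvd_fraction_map
    (K := coeffField F m) h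
  exact (map_dvd_iff (lastEquiv F m)).mp this

/-- The last variable is transcendental over `coeffField F m`: a relation, cleared of denominators,
would be one between polynomials. -/
theorem evalLastHom_injective : Function.Injective (evalLastHom F m) := by
  let := (coeffMap F m).toAlgebra
  have := isFractionRing_coeffMap (F := F) (m := m)
  rw [injective_iff_map_eq_zero]
  intro p hp
  obtain ⟨b, q', hb, hbp⟩ := exists_map_eq_C_mul (A := MvPolynomial (Fin m) F) p
  obtain ⟨q, rfl⟩ := (lastEquiv F m).surjective q'
  have hqp : toPoly F m q = Polynomial.C (coeffMap F m b) * p := hbp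
  have hq0 : q = 0 := by
    have := evalLastHom_toPoly q
    rw [hqp, map_mul, hp, mul_zero] at this
    exact (map_eq_zero_iff _ (IsFractionRing.injective _ _)).mp this.symm
  rw [hq0, map_zero] at hqp
  refine (mul_eq_zero.mp hqp.symm).resolve_left fun h => hb ?_
  exact (map_eq_zero_iff (coeffMap F m) coeffMap_injective).mp (Polynomial.C_eq_zero.mp h)

theorem exists_mul_evalLastHom_eq (x : RatField F (m + 1)) :
    ∃ P Q : Polynomial (coeffField F m), Q ≠ 0 ∧ x * evalLastHom F m Q = evalLastHom F m P := by
  obtain ⟨p, q, hq, rfl⟩ := IsFractionRing.div_surjective (A := MvPolynomial (Fin (m + 1)) F) x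
  have hq0 : q ≠ 0 := nonZeroDivisors.ne_zero hq
  refine ⟨toPoly F m p, toPoly F m q, (map_ne_zero_iff _ toPoly_injective).mpr hq0, ?_⟩
  rw [evalLastHom_toPoly, evalLastHom_toPoly, div_mul_cancel₀]
  exact (map_ne_zero_iff _ (IsFractionRing.injective _ _)).mpr hq0

/-! ### The action of `σ` on polynomials in the last variable. -/

variable (lam : Fin (m + 1) → Fˣ)

theorem sigma_mem_coeffField {x : RatField F (m + 1)} (hx : x ∈ coeffField F m) :
    sigma lam x ∈ coeffField F m := by
  have h : coeffField F m ≤ (coeffField F m).comap (sigma lam).toAlgHom := by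
    refine IntermediateField.adjoin_le_iff.mpr ?_
    rintro _ ⟨i, rfl⟩
    change sigma lam (gen F i.castSucc) ∈ coeffField F m
    rw [sigma_gen]
    exact (coeffField F m).smul_mem (IntermediateField.subset_adjoin F _ ⟨i, rfl⟩)
  exact h hx

/-- The restriction of `σ` to `coeffField F m`. -/
def sigmaCoeff : coeffField F m →ₐ[F] coeffField F m :=
  ((sigma lam).toAlgHom.comp (coeffField F m).val).codRestrict (coeffField F m).toSubalgebra
    fun x => sigma_mem_coeffField lam x.2

/-- The lift of `σ` to the polynomials in the last variable. -/
def sigmaLift : Polynomial (coeffField F m) →+* Polynomial (coeffField F m) :=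
  (Polynomial.compRingHom
      (Polynomial.C (algebraMap F (coeffField F m) (lam (Fin.last m))) * Polynomial.X)).comp
    (Polynomial.mapRingHom (sigmaCoeff lam : coeffField F m →+* coeffField F m))

theorem coeff_sigmaLift (p : Polynomial (coeffField F m)) (n : ℕ) :
    (sigmaLift lam p).coeff n =
      sigmaCoeff lam (p.coeff n) * algebraMap F (coeffField F m) (lam (Fin.last m)) ^ n := by
  simp [sigmaLift, Polynomial.comp_C_mul_X_coeff]

theorem sigmaLift_X : sigmaLift lam Polynomial.X =
    Polynomial.C (algebraMap F (coeffField F m) (lam (Fin.last m))) * Polynomial.X := by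
  simp [sigmaLift]

theorem degree_sigmaLift (p : Polynomial (coeffField F m)) :
    (sigmaLift lam p).degree = p.degree := by
  have : (sigmaLift lam p).support = p.support := by
    ext n
    simp [Polynomial.mem_support_iff, coeff_sigmaLift]
  rw [Polynomial.degree, Polynomial.degree, this]

theorem degree_sigmaLift_pow (k : ℕ) (p : Polynomial (coeffField F m)) :
    ((sigmaLift lam ^ k) p).degree = p.degree := by
  induction k with
  | zero => rfl
  | succ k ih => rw [pow_succ', RingHom.mul_def, RingHom.comp_apply, degree_sigmaLift, ih]

theorem sigma_evalLastHom (p : Polynomial (coeffField F m)) :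
    sigma lam (evalLastHom F m p) = evalLastHom F m (sigmaLift lam p) := by
  suffices h : (sigma lam : RatField F (m + 1) →+* RatField F (m + 1)).comp (evalLastHom F m) =
      (evalLastHom F m).comp (sigmaLift lam) from DFunLike.congr_fun h p
  refine Polynomial.ringHom_ext (fun x => ?_) ?_
  · simp [sigmaLift]
    rfl
  · simp [sigmaLift_X, sigma_gen, Algebra.smul_def]

theorem sigma_pow_evalLastHom (k : ℕ) (p : Polynomial (coeffField F m)) :
    (sigma lam ^ k) (evalLastHom F m p) = evalLastHom F m ((sigmaLift lam ^ k) p) := by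
  induction k with
  | zero => rfl
  | succ k ih =>
    rw [pow_succ', pow_succ', AlgEquiv.mul_apply, ih, sigma_evalLastHom]
    rfl

theorem sigma_pow_algebraMap (k : ℕ) (p : MvPolynomial (Fin (m + 1)) F) :
    (sigma lam ^ k) (algebraMap _ (RatField F (m + 1)) p) =
      algebraMap _ (RatField F (m + 1)) ((sigmaPoly lam ^ k) p) := by
  induction k with
  | zero => rfl
  | succ k ih => rw [pow_succ', pow_succ', AlgEquiv.mul_apply, ih, sigma_algebraMap]; rfl

theorem sigmaLift_pow_toPoly (k : ℕ) (p : MvPolynomial (Fin (m + 1)) F) :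
    (sigmaLift lam ^ k) (toPoly F m p) = toPoly F m ((sigmaPoly lam ^ k) p) := by
  apply evalLastHom_injective
  rw [← sigma_pow_evalLastHom, evalLastHom_toPoly, evalLastHom_toPoly, sigma_pow_algebraMap]

theorem X_dvd_sigmaLift_pow_X (k : ℕ) :
    (Polynomial.X : Polynomial (coeffField F m)) ∣ (sigmaLift lam ^ k) Polynomial.X := by
  rw [Polynomial.X_dvd_iff]
  induction k with
  | zero => simp
  | succ k ih =>
    rw [pow_succ', RingHom.mul_def, RingHom.comp_apply, coeff_sigmaLift, ih]
    simp

/-- Distinct powers of `σ` below the period of `d` give coprime polynomials. -/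
theorem isCoprime_sigmaLift_pow_toPoly {d : MvPolynomial (Fin (m + 1)) F} (hd : Irreducible d)
    (h0 : degreeOf (Fin.last m) d ≠ 0) {k : ℕ}
    (hspr : spread lam d d = (AddSubgroup.zmultiples (k : ℤ) : Set ℤ)) {i : ℕ} (hi : 0 < i)
    (hik : i < k) : IsCoprime ((sigmaLift lam ^ i) (toPoly F m d)) (toPoly F m d) := by
  refine (((irreducible_toPoly hd h0).coprime_iff_not_dvd).mpr fun hdvd => ?_).symm
  have hirr : Irreducible ((sigmaPoly lam ^ i) d) :=
    (MulEquiv.irreducible_iff (sigmaPoly lam ^ i)).mpr hd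
  rw [sigmaLift_pow_toPoly] at hdvd
  -- Divisibility between irreducibles gives associates, and units are constants of `F`; thus `i`
  -- would lie in the spread, contradicting `0 < i < k`.
  obtain ⟨v, hv⟩ := hd.associated_of_dvd hirr (dvd_of_toPoly_dvd_toPoly hd h0 hdvd)
  obtain ⟨w, hw, hvw⟩ := MvPolynomial.isUnit_iff_eq_C_of_isReduced.mp v.isUnit
  have hmem : (i : ℤ) ∈ spread lam d d :=
    ⟨w, hw.ne_zero, by rw [zpow_natCast, ← hv, hvw, mul_comm]⟩
  rw [hspr, SetLike.mem_coe, Int.mem_zmultiples_iff, Int.natCast_dvd_natCast] at hmem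
  exact absurd (Nat.le_of_dvd hi hmem) (not_le.mpr hik)

end Concrete

end DiffField

end

noncomputable section

namespace DiffField

open MvPolynomial

/-! ### Geometric sums in `cσ` and the two implications. -/

section Main

variable {F : Type*} [Field F] {m : ℕ}

/-- The operator `c σ` on the field of rational functions. -/
def smulSigma (lam : Fin (m + 1) → Fˣ) (c : F) : Module.End F (RatField F (m + 1)) :=
  c • (sigma lam).toLinearMap

theorem smulSigma_pow_apply (lam : Fin (m + 1) → Fˣ) (c : F) (i : ℕ) (x : RatField F (m + 1)) :
    (smulSigma lam c ^ i) x = c ^ i • (sigma lam ^ i) x := by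
  induction i with
  | zero => simp
  | succ i ih =>
    rw [pow_succ', pow_succ', pow_succ', Module.End.mul_apply, ih, AlgEquiv.mul_apply, mul_smul]
    simp [smulSigma, smul_comm c]

theorem delta_sigma_eq (lam : Fin (m + 1) → Fˣ) (c : F) (g : RatField F (m + 1)) :
    delta c (sigma lam) g = (smulSigma lam c - 1) g := rfl

theorem delta_sigma_pow_eq (lam : Fin (m + 1) → Fˣ) (c : F) (k : ℕ) (g : RatField F (m + 1)) :
    delta (c ^ k) (sigma lam ^ k) g = (smulSigma lam c ^ k - 1) g := by
  rw [LinearMap.sub_apply, smulSigma_pow_apply]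
  rfl

/-- A `cᵏσᵏ`-summable element is `cσ`-summable. -/
theorem isSummable_of_delta_pow (lam : Fin (m + 1) → Fˣ) (c : F) (k : ℕ)
    (g : RatField F (m + 1)) : IsSummable lam c (delta (c ^ k) (sigma lam ^ k) g) :=
  ⟨(∑ i ∈ Finset.range k, smulSigma lam c ^ i) g, by
    rw [delta_sigma_pow_eq, delta_sigma_eq, ← Module.End.mul_apply, mul_geom_sum]⟩

theorem sum_smulSigma_pow_delta (lam : Fin (m + 1) → Fˣ) (c : F) (k : ℕ)
    (g : RatField F (m + 1)) :
    ∑ i ∈ Finset.range k, (smulSigma lam c ^ i) (delta c (sigma lam) g) =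
      delta (c ^ k) (sigma lam ^ k) g := by
  rw [delta_sigma_pow_eq, delta_sigma_eq, ← geom_sum_mul, Module.End.mul_apply,
    LinearMap.sum_apply]

/-- `c • τ g - g` on the level of polynomials in the last variable. -/
theorem delta_evalLast (lam : Fin (m + 1) → Fˣ) (e : F) (k : ℕ)
    (b : Polynomial (coeffField F m)) :
    delta e (sigma lam ^ k) (evalLast b) = evalLast
      (Polynomial.C (algebraMap F (coeffField F m) e) * (sigmaLift lam ^ k) b - b) := by
  simp only [delta, ← evalLastHom_apply, sigma_pow_evalLastHom, map_sub, map_mul,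
    evalLastHom_C_algebraMap, Algebra.smul_def]

theorem isSummable_of_eq_delta (lam : Fin (m + 1) → Fˣ) (c : F)
    {d : MvPolynomial (Fin (m + 1)) F} (hd0 : d ≠ 0) (j k : ℕ) {u : F} (hu : u ≠ 0)
    (hdu : (sigmaPoly lam ^ k) d = C u * d) {a b : RatField F (m + 1)}
    (hab : a = delta (c ^ k * (u ^ j)⁻¹) (sigma lam ^ k) b) :
    IsSummable lam c (a / algebraMap _ (RatField F (m + 1)) d ^ j) := by
  have hd1 : algebraMap _ (RatField F (m + 1)) d ≠ 0 :=
    (map_ne_zero_iff _ (IsFractionRing.injective _ _)).mpr hd0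
  have hu1 : algebraMap F (RatField F (m + 1)) u ≠ 0 := by simpa using hu
  have hC : algebraMap (MvPolynomial (Fin (m + 1)) F) (RatField F (m + 1)) (C u) =
      algebraMap F (RatField F (m + 1)) u := by
    rw [← algebraMap_eq, ← IsScalarTower.algebraMap_apply]
  convert isSummable_of_delta_pow lam c k (b / algebraMap _ (RatField F (m + 1)) d ^ j)
  rw [hab, delta, delta, map_div₀, map_pow, sigma_pow_algebraMap, hdu, map_mul, hC,
    Algebra.smul_def, Algebra.smul_def, map_mul, map_inv₀, map_pow, map_pow]
  rw [mul_pow]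
  field_simp

theorem exists_solution_of_isSummable (lam : Fin (m + 1) → Fˣ) (c : F)
    {d : MvPolynomial (Fin (m + 1)) F} (hd : Irreducible d) {j : ℕ} (hj : 0 < j)
    {a : Polynomial (coeffField F m)}
    (ha : a.degree < (degreeOf (Fin.last m) d : WithBot ℕ)) {k : ℕ} (hk : 0 < k)
    (hspr : spread lam d d = (AddSubgroup.zmultiples (k : ℤ) : Set ℤ)) {u : F} (hu : u ≠ 0)
    (hdu : (sigmaPoly lam ^ k) d = C u * d)
    (hsum : IsSummable lam c (evalLast a / algebraMap _ (RatField F (m + 1)) d ^ j)) :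
    ∃ b : Polynomial (coeffField F m), b.degree < (degreeOf (Fin.last m) d : WithBot ℕ) ∧
      Polynomial.C (algebraMap F (coeffField F m) (c ^ k * (u ^ j)⁻¹)) * (sigmaLift lam ^ k) b
        - b = a := by
  -- If `d` is free of the last variable, it becomes a unit in `K[αₙ]` and localisation says
  -- nothing; but then `a = 0`.
  by_cases h0 : degreeOf (Fin.last m) d = 0
  · have ha0 : a = 0 := by
      rw [h0, Nat.cast_zero] at ha
      exact Polynomial.degree_eq_bot.mp (Nat.WithBot.lt_zero_iff.mp ha)
    exact ⟨0, by simp [h0], by simp [ha0]⟩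
  obtain ⟨g, hg⟩ := hsum
  have hdeg := degree_toPoly (m := m) hd.ne_zero
  have hirr := irreducible_toPoly hd h0
  have hdu' : (sigmaLift lam ^ k) (toPoly F m d) =
      Polynomial.C (algebraMap F (coeffField F m) u) * toPoly F m d := by
    rw [sigmaLift_pow_toPoly, hdu, map_mul]
    congr 1
    simp [toPoly, lastEquiv]
  rw [← hdeg] at ha
  -- The omitted index `0` contributes `f` itself, the only summand that may have a pole at `d`.
  have hterm : ∀ i ∈ Finset.range k \ {0}, HasCoprimeDenom (evalLastHom F m) (toPoly F m d)
      ((smulSigma lam c ^ i)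
        (evalLast a / algebraMap _ (RatField F (m + 1)) d ^ j)) := by
    intro i hi
    simp only [Finset.mem_sdiff, Finset.mem_range, Finset.mem_singleton] at hi
    have hco := isCoprime_sigmaLift_pow_toPoly lam hd h0 hspr (Nat.pos_of_ne_zero hi.2) hi.1
    rw [smulSigma_pow_apply, Algebra.smul_def, ← evalLastHom_C_algebraMap]
    refine HasCoprimeDenom.poly_mul _
      ⟨(sigmaLift lam ^ i) a, (sigmaLift lam ^ i) (toPoly F m d) ^ j, hco.pow_left, ?_⟩
    rw [map_div₀, map_pow, ← evalLastHom_apply, ← evalLastHom_toPoly, sigma_pow_evalLastHom,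
      sigma_pow_evalLastHom, map_pow, div_mul_cancel₀]
    refine pow_ne_zero _ ((map_ne_zero_iff _ evalLastHom_injective).mpr ?_)
    intro hz
    rw [← Polynomial.degree_eq_bot, degree_sigmaLift_pow, Polynomial.degree_eq_bot] at hz
    exact hirr.ne_zero hz
  have key := sum_smulSigma_pow_delta lam c k g
  rw [← hg, ← Finset.sum_sdiff (Finset.singleton_subset_iff.mpr (Finset.mem_range.mpr hk)),
    Finset.sum_singleton, pow_zero, Module.End.one_apply, delta, Algebra.smul_def,
    ← evalLastHom_C_algebraMap, ← evalLastHom_toPoly, ← evalLastHom_apply] at key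
  obtain ⟨b, hb, hab⟩ := exists_solution_of_local (sigmaLift lam ^ k)
    (s := ((sigma lam ^ k : RatField F (m + 1) ≃ₐ[F] RatField F (m + 1)) :
      RatField F (m + 1) →+* RatField F (m + 1)))
    (degree_sigmaLift_pow lam k) evalLastHom_injective exists_mul_evalLastHom_eq
    (sigma_pow_evalLastHom lam k) hirr
    (by simpa using hu) hdu' hj ha (HasCoprimeDenom.sum hterm)
    (by rw [← evalLastHom_apply, ← evalLastHom_toPoly]; exact key.symm.trans (add_comm _ _))
  refine ⟨b, hdeg ▸ hb, ?_⟩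
  rw [← hab]
  simp only [map_mul, map_pow, map_inv₀]

/-- A solution can be truncated at the degree of the right-hand side. -/
theorem exists_solution_degree_le (lam : Fin (m + 1) → Fˣ) (e : F) (k : ℕ)
    {a b : Polynomial (coeffField F m)}
    (h : Polynomial.C (algebraMap F (coeffField F m) e) * (sigmaLift lam ^ k) b - b = a) :
    ∃ b' : Polynomial (coeffField F m), b'.degree ≤ a.degree ∧
      Polynomial.C (algebraMap F (coeffField F m) e) * (sigmaLift lam ^ k) b' - b' = a := by
  -- Here the bound `⊥` forces the solution `0`, whereas reduction modulo `X ^ (0 + 1)` could leave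
  -- a nonzero constant.
  by_cases ha : a = 0
  · exact ⟨0, by simp, by simp [ha]⟩
  have hX : (Polynomial.X ^ (a.natDegree + 1) : Polynomial (coeffField F m)).degree =
      ((a.natDegree + 1 : ℕ) : WithBot ℕ) := Polynomial.degree_X_pow _
  refine ⟨b % Polynomial.X ^ (a.natDegree + 1), ?_,
    mul_map_mod_sub_eq (sigmaLift lam ^ k) (degree_sigmaLift_pow lam k) _ ?_ ?_ ?_⟩
  · have := EuclideanDomain.mod_lt b
      (pow_ne_zero (a.natDegree + 1) (Polynomial.X_ne_zero (R := coeffField F m)))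
    replace this : (b % Polynomial.X ^ (a.natDegree + 1)).degree <
      (Polynomial.X ^ (a.natDegree + 1) : Polynomial (coeffField F m)).degree := this
    rw [hX] at this
    rw [Polynomial.degree_eq_natDegree ha]
    exact (Polynomial.degree_le_iff_coeff_zero _ _).mpr fun n hn =>
      (Polynomial.degree_lt_iff_coeff_zero _ _).mp this n
        (Nat.succ_le_of_lt (WithBot.coe_lt_coe.mp hn))
  · rw [map_pow]
    exact pow_dvd_pow_of_dvd (X_dvd_sigmaLift_pow_X lam k) _
  · rw [hX, Polynomial.degree_eq_natDegree ha]
    exact_mod_cast Nat.lt_succ_self _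
  · rw [h, sub_self]
    exact dvd_zero _

end Main

end DiffField

end

theorem mainTheorem1 {F : Type*} [Field F] (m : ℕ) (lam : Fin (m + 1) → Fˣ)
    (c : F) (hc : c ≠ 0)
    (d : MvPolynomial (Fin (m + 1)) F) (hd : Irreducible d)
    (hdlast : ¬ DiffField.SigmaEquiv lam d (MvPolynomial.X (Fin.last m)))
    (j : ℕ) (hj : 0 < j)
    (a : Polynomial (DiffField.coeffField F m))
    (ha : a.degree < (MvPolynomial.degreeOf (Fin.last m) d : WithBot ℕ))
    (k : ℕ) (hk : 0 < k)
    (hspr : DiffField.spread lam d d = (AddSubgroup.zmultiples (k : ℤ) : Set ℤ))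
    (u : F) (hu : u ≠ 0)
    (hdu : (DiffField.sigmaPoly lam ^ k) d = MvPolynomial.C u * d) :
    (DiffField.IsSummable lam c
        (DiffField.evalLast a / algebraMap _ (DiffField.RatField F (m + 1)) d ^ j) ↔
      ∃ b : Polynomial (DiffField.coeffField F m),
        b.degree < (MvPolynomial.degreeOf (Fin.last m) d : WithBot ℕ) ∧
        DiffField.evalLast a =
          DiffField.delta (c ^ k * (u ^ j)⁻¹) (DiffField.sigma lam ^ k)
            (DiffField.evalLast b)) ∧
    (DiffField.IsSummable lam c
        (DiffField.evalLast a / algebraMap _ (DiffField.RatField F (m + 1)) d ^ j) ↔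
      ∃ b : Polynomial (DiffField.coeffField F m),
        b.degree ≤ a.degree ∧
        DiffField.evalLast a =
          DiffField.delta (c ^ k * (u ^ j)⁻¹) (DiffField.sigma lam ^ k)
            (DiffField.evalLast b)) := by
  have hsuff : ∀ b : Polynomial (DiffField.coeffField F m),
      DiffField.evalLast a = DiffField.delta (c ^ k * (u ^ j)⁻¹) (DiffField.sigma lam ^ k)
        (DiffField.evalLast b) → DiffField.IsSummable lam c
        (DiffField.evalLast a / algebraMap _ (DiffField.RatField F (m + 1)) d ^ j) :=
    fun b hab => DiffField.isSummable_of_eq_delta lam c hd.ne_zero j k hu hdu hab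
  refine ⟨⟨fun h => ?_, fun ⟨b, _, hab⟩ => hsuff b hab⟩,
    ⟨fun h => ?_, fun ⟨b, _, hab⟩ => hsuff b hab⟩⟩
  · obtain ⟨b, hb, hab⟩ :=
      DiffField.exists_solution_of_isSummable lam c hd hj ha hk hspr hu hdu h
    exact ⟨b, hb, by rw [DiffField.delta_evalLast, hab]⟩
  · obtain ⟨b, -, hab⟩ :=
      DiffField.exists_solution_of_isSummable lam c hd hj ha hk hspr hu hdu h
    obtain ⟨b', hb', hab'⟩ := DiffField.exists_solution_degree_le lam _ k hab
    exact ⟨b', hb', by rw [DiffField.delta_evalLast, hab']⟩
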